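/- Let $n \ge 2$ and let $K \subset \mathbb{R}^n$ be a symmetric convex body, that is, a compact convex set with nonempty interior such that $K = -K$. Suppose that there is a nonempty relatively open subset $U$ of the boundary $\partial K$ such that $\partial K$ is a hypersurface of class $C^2$ near every point of $U$ and all the principal curvatures of $\partial K$ (with respect to the outward unit normal $\nu$, i.e. the eigenvalues of the differential of $\nu$ on the tangent space) are positive at every point of $U$. Then $K$ is SRS-decomposable: there exist a vector $v \in \mathbb{R}^n \setminus \{0\}$, a number $\epsilon > 0$ and a function $\beta : \pi_v(K) \to \mathbb{R}$, where $\pi_v : \mathbb{R}^n \to v^\perp$ is the orthogonal projection, such that $\beta$ is odd ($\beta(-x) = -\beta(x)$ for all $x \in \pi_v(K)$), $\beta$ is not the restriction to $\pi_v(K)$ of a linear function on $v^\perp$, and for every $t \in (-\epsilon, \epsilon)$ the set $$K_t = \{ x + t \beta(\pi_v(x)) v : x \in K \}$$ is convex. -/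

import Mathlib

open scoped InnerProductSpace Pointwise

noncomputable section

namespace SRS

/-- Euclidean space `ℝⁿ`. -/
abbrev E (n : ℕ) := EuclideanSpace ℝ (Fin n)

/-- A symmetric convex body: a compact convex set with nonempty interior and `-K = K`. -/
structure IsSymmConvexBody {n : ℕ} (K : Set (E n)) : Prop where
  convex : Convex ℝ K
  isCompact : IsCompact K
  interior_nonempty : (interior K).Nonempty
  neg_eq : -K = K

/-- The hyperplane `v^⊥`. -/
abbrev perp {n : ℕ} (v : E n) : Submodule ℝ (E n) := (Submodule.span ℝ {v})ᗮ

/-- Orthogonal projection `π_v : ℝⁿ → v^⊥`. -/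
abbrev proj {n : ℕ} (v : E n) : E n →L[ℝ] perp v := (perp v).orthogonalProjectionOnto

/-- The set `K_t = {x + t β(π_v x) v : x ∈ K}`. Only the values of `β` on `π_v(K)` matter. -/
def move {n : ℕ} (K : Set (E n)) (v : E n) (β : perp v → ℝ) (t : ℝ) : Set (E n) :=
  (fun x => x + (t * β (proj v x)) • v) '' K

/-- The family `K_t`, `t ∈ I`, with direction `v ≠ 0` and speed function `β`, is an RS-movement
of `K`: `I` is an interval containing `0` and each `K_t` is convex. -/
structure IsRSMovement {n : ℕ} (K : Set (E n)) (v : E n) (β : perp v → ℝ) (I : Set ℝ) :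
    Prop where
  ne_zero : v ≠ 0
  ordConnected : I.OrdConnected
  zero_mem : (0 : ℝ) ∈ I
  convex : ∀ t ∈ I, Convex ℝ (move K v β t)

/-- An SRS-movement: an RS-movement whose speed function is odd on `π_v(K)`. -/
structure IsSRSMovement {n : ℕ} (K : Set (E n)) (v : E n) (β : perp v → ℝ) (I : Set ℝ) : Prop
    extends IsRSMovement K v β I where
  odd : ∀ x ∈ proj v '' K, β (-x) = -β x

/-- `β` is (the restriction of) a linear function on the set `S`. -/
def IsLinearOn {n : ℕ} {v : E n} (β : perp v → ℝ) (S : Set (perp v)) : Prop :=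
  ∃ l : perp v →ₗ[ℝ] ℝ, ∀ x ∈ S, β x = l x

/-- `K` is SRS-decomposable: there is an SRS-movement `K_t`, `t ∈ (-ε, ε)`, with `K_0 = K`, whose
speed function is not linear on `π_v(K)`. -/
def SRSDecomposable {n : ℕ} (K : Set (E n)) : Prop :=
  ∃ (v : E n) (β : perp v → ℝ) (ε : ℝ), 0 < ε ∧
    IsSRSMovement K v β (Set.Ioo (-ε) ε) ∧ move K v β 0 = K ∧
    ¬ IsLinearOn β (proj v '' K)

/-- `ρ` is a `C²` local defining function of `∂K` on the open neighbourhood `W` of `p ∈ ∂K`: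
inside `W`, the boundary is the regular zero set of `ρ`. It is oriented so that `ρ < 0` inside `K`,
i.e. `∇ρ` is an outward normal of `∂K`. -/
structure IsLocalDefining {n : ℕ} (K : Set (E n)) (p : E n) (W : Set (E n)) (ρ : E n → ℝ) :
    Prop where
  mem_frontier : p ∈ frontier K
  isOpen : IsOpen W
  mem : p ∈ W
  contDiffOn : ContDiffOn ℝ 2 ρ W
  gradient_ne_zero : ∀ x ∈ W, gradient ρ x ≠ 0
  frontier_iff : ∀ x ∈ W, x ∈ frontier K ↔ ρ x = 0
  neg_interior : ∀ x ∈ W, x ∈ interior K → ρ x < 0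

/-- `∂K` is a hypersurface of class `C²` near `p`. -/
def BoundaryC2At {n : ℕ} (K : Set (E n)) (p : E n) : Prop :=
  ∃ (W : Set (E n)) (ρ : E n → ℝ), IsLocalDefining K p W ρ

/-- The unit normal field `∇ρ / |∇ρ|` of the level sets of `ρ`. -/
def unitNormal {n : ℕ} (ρ : E n → ℝ) (x : E n) : E n := ‖gradient ρ x‖⁻¹ • gradient ρ x

/-- `κ` is a principal curvature of `∂K` at `p`: an eigenvalue, with an eigenvector in the tangent
space `T_p ∂K = (∇ρ(p))^⊥`, of the Weingarten map, the differential of the outward unit normal.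
(This does not depend on the choice of the local defining function. The sign is such that the unit
sphere, as the boundary of the unit ball, has all principal curvatures `1`.) -/
def IsPrincipalCurvature {n : ℕ} (K : Set (E n)) (p : E n) (κ : ℝ) : Prop :=
  ∃ (W : Set (E n)) (ρ : E n → ℝ), IsLocalDefining K p W ρ ∧
    ∃ w : E n, w ≠ 0 ∧ ⟪gradient ρ p, w⟫_ℝ = 0 ∧ fderiv ℝ (unitNormal ρ) p w = κ • w

end SRS

end

/-! Near a boundary point `p` with positive curvatures, `K` is uniformly convex: the midpoint of a
chord `XY` near `p` is the centre of a ball in `K` of radius `c‖X - Y‖²`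
(`exists_uniformlyConvexNear`). Only this property is used afterwards.

Choose a second boundary point `q` close to `p` and set `v = p - q`. Then `p` and `q` are the top
and the bottom of `K` over the same point `x₀` of `v^⊥`. By symmetry `-q`, which is close to `-p`,
is the top over `-x₀`. So the upper height function `top K v` is strongly concave near both `x₀` and
`-x₀` (`exists_top_midpoint`), and `x₀ ≠ 0` because `q` is too close to `p` to be `-p`.

Let `β` be an odd difference of bumps at `x₀` and `-x₀`. For small `t` the strong concavity absorbs
`tβ`, so `top K v + tβ` is concave (`exists_concaveOn_add_mul`). The lower boundary is `x ↦ -top K v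
(-x)`, so for odd `β` the same concavity makes the moved lower boundary convex, and `K_t` is convex
(`convex_move`). Since `β` is `1` at `x₀` and `0` at `x₀ / 2`, it is not linear. -/

namespace SRS

open Filter Topology

/-! ### Coercivity and strong convexity -/

/-- A bounded bilinear form that is coercive on `g^⊥` becomes coercive after adding a multiple of
`⟪g, ·⟫²`. -/
theorem exists_coercive_add_inner_sq {F : Type*} [NormedAddCommGroup F] [InnerProductSpace ℝ F]
    (H : F →L[ℝ] F) {g : F} (hg : g ≠ 0) {κ : ℝ} (hκ : 0 < κ)
    (h : ∀ w, ⟪g, w⟫_ℝ = 0 → κ * ‖w‖ ^ 2 ≤ ⟪H w, w⟫_ℝ) :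
    ∃ A : ℝ, 0 ≤ A ∧ ∃ c : ℝ, 0 < c ∧
      ∀ w, c * ‖w‖ ^ 2 ≤ ⟪H w, w⟫_ℝ + A * ⟪g, w⟫_ℝ ^ 2 := by
  have hg' : 0 < ‖g‖ := norm_pos_iff.2 hg
  set b := ‖H‖ with hb
  have hb0 : 0 ≤ b := norm_nonneg H
  -- With `w = u + s • g`, `u ⊥ g`, the cross terms are at least `-2b‖u‖(|s|‖g‖)`. Completing the
  -- square spends `κ/2 ‖u‖²` and `2b²/κ (|s|‖g‖)²` on them; the other terms of the constant pay for
  -- `⟪H g, g⟫` and for coercivity along `g`.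
  refine ⟨(b + 2 * b ^ 2 / κ + κ / 2) / ‖g‖ ^ 2, by positivity, κ / 2, by positivity, fun w => ?_⟩
  set s := ⟪g, w⟫_ℝ / ‖g‖ ^ 2 with hs
  set u := w - s • g with hu
  have hgs : ⟪g, w⟫_ℝ = s * ‖g‖ ^ 2 := by rw [hs]; field_simp
  have hgu : ⟪g, u⟫_ℝ = 0 := by
    rw [hu, inner_sub_right, inner_smul_right, real_inner_self_eq_norm_sq, hgs]; ring
  have hw : w = u + s • g := by rw [hu]; abel
  have hbd : ∀ x y : F, |⟪H x, y⟫_ℝ| ≤ b * ‖x‖ * ‖y‖ := fun x y =>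
    (abs_real_inner_le_norm _ _).trans
      (mul_le_mul_of_nonneg_right (H.le_opNorm x) (norm_nonneg y))
  have hnorm : ‖w‖ ^ 2 = ‖u‖ ^ 2 + (|s| * ‖g‖) ^ 2 := by
    rw [hw, ← real_inner_self_eq_norm_sq, inner_add_left, inner_add_right, inner_add_right,
      inner_smul_left, inner_smul_right, inner_smul_left, inner_smul_right,
      real_inner_comm g u, hgu, real_inner_self_eq_norm_sq, real_inner_self_eq_norm_sq, mul_pow,
      sq_abs]
    simp
    ring
  have hexp : ⟪H w, w⟫_ℝ = ⟪H u, u⟫_ℝ + s * ⟪H u, g⟫_ℝ + s * ⟪H g, u⟫_ℝ + s ^ 2 * ⟪H g, g⟫_ℝ := by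
    rw [hw, map_add, map_smul, inner_add_left, inner_add_right, inner_add_right,
      inner_smul_left, inner_smul_right, inner_smul_left, inner_smul_right]
    simp
    ring
  have h1 := h u hgu
  have h2 : -(|s| * (b * ‖u‖ * ‖g‖)) ≤ s * ⟪H u, g⟫_ℝ := by
    have := mul_le_mul_of_nonneg_left (hbd u g) (abs_nonneg s)
    rw [← abs_mul] at this
    exact (neg_le_neg this).trans (neg_abs_le _)
  have h3 : -(|s| * (b * ‖g‖ * ‖u‖)) ≤ s * ⟪H g, u⟫_ℝ := by
    have := mul_le_mul_of_nonneg_left (hbd g u) (abs_nonneg s)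
    rw [← abs_mul] at this
    exact (neg_le_neg this).trans (neg_abs_le _)
  have h4 : -(s ^ 2 * (b * ‖g‖ * ‖g‖)) ≤ s ^ 2 * ⟪H g, g⟫_ℝ := by
    have := mul_le_mul_of_nonneg_left (neg_le_of_abs_le (hbd g g)) (sq_nonneg s)
    linarith
  rw [hnorm, hexp, hgs]
  have h5 : (b + 2 * b ^ 2 / κ + κ / 2) / ‖g‖ ^ 2 * (s * ‖g‖ ^ 2) ^ 2 =
      (b + 2 * b ^ 2 / κ + κ / 2) * (|s| * ‖g‖) ^ 2 := by
    rw [mul_pow |s|, sq_abs]; field_simp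
  rw [h5]
  have h6 : s ^ 2 * (b * ‖g‖ * ‖g‖) = b * (|s| * ‖g‖) ^ 2 := by rw [mul_pow |s|, sq_abs]; ring
  have h7 : 0 ≤ κ / 2 * (‖u‖ - 2 * b * (|s| * ‖g‖) / κ) ^ 2 := by positivity
  have h8 : κ / 2 * (‖u‖ - 2 * b * (|s| * ‖g‖) / κ) ^ 2 =
      κ / 2 * ‖u‖ ^ 2 - 2 * b * (|s| * ‖g‖) * ‖u‖ + 2 * b ^ 2 / κ * (|s| * ‖g‖) ^ 2 := by
    field_simp; ring
  nlinarith

/-- A symmetric operator whose compression to `g^⊥` has only positive eigenvalues is coercive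
on `g^⊥`. -/
theorem exists_coercive_on_orthogonal {F : Type*} [NormedAddCommGroup F] [InnerProductSpace ℝ F]
    [FiniteDimensional ℝ F] (H : F →L[ℝ] F) (hsymm : ∀ x y, ⟪H x, y⟫_ℝ = ⟪x, H y⟫_ℝ) (g : F)
    (h : ∀ (κ : ℝ) (w : F), w ≠ 0 → ⟪g, w⟫_ℝ = 0 →
      H w - κ • w ∈ Submodule.span ℝ {g} → 0 < κ) :
    ∃ κ : ℝ, 0 < κ ∧ ∀ w, ⟪g, w⟫_ℝ = 0 → κ * ‖w‖ ^ 2 ≤ ⟪H w, w⟫_ℝ := by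
  let T := (Submodule.span ℝ {g})ᗮ
  have hT : ∀ w, w ∈ T ↔ ⟪g, w⟫_ℝ = 0 := fun w => Submodule.mem_orthogonal_singleton_iff_inner_right
  rcases subsingleton_or_nontrivial T with hs | hs
  · refine ⟨1, one_pos, fun w hw => ?_⟩
    have : (⟨w, (hT w).2 hw⟩ : T) = 0 := Subsingleton.elim _ _
    have : w = 0 := congrArg Subtype.val this
    simp [this]
  let L : T →L[ℝ] T := T.orthogonalProjectionOnto ∘L H ∘L T.subtypeL
  have hLin : ∀ x y : T, ⟪L x, y⟫_ℝ = ⟪H x, (y : F)⟫_ℝ := fun x y =>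
    Submodule.inner_orthogonalProjectionOnto_eq_of_mem_right y (H x)
  have hL : (L : T →ₗ[ℝ] T).IsSymmetric := fun x y => by
    change ⟪L x, y⟫_ℝ = ⟪x, L y⟫_ℝ
    rw [hLin, hsymm, real_inner_comm (L y) x, hLin, real_inner_comm]
  -- The minimum of the Rayleigh quotient is an eigenvalue of the compression `L`, so the hypothesis
  -- makes it positive, and it is the coercivity constant.
  have hev := hL.hasEigenvalue_iInf_of_finiteDimensional
  set κ := ⨅ x : { x : T // x ≠ 0 }, RCLike.re ⟪(L : T →ₗ[ℝ] T) x, x⟫_ℝ / ‖(x : T)‖ ^ 2 with hκ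
  obtain ⟨w, hw⟩ := hev.exists_hasEigenvector
  refine ⟨κ, ?_, fun w hw => ?_⟩
  · refine h κ w (by simpa using hw.2) ((hT w).1 w.2) ?_
    have h1 : L w = κ • w := hw.apply_eq_smul
    rw [← Submodule.orthogonal_orthogonal (Submodule.span ℝ {g})]
    have h2 : H w - (T.orthogonalProjectionOnto (H w) : F) ∈ Tᗮ :=
      Submodule.sub_starProjection_mem_orthogonal (H w)
    have h3 : (T.orthogonalProjectionOnto (H w) : F) = κ • (w : F) := congrArg Subtype.val h1
    rwa [h3] at h2
  · rcases eq_or_ne w 0 with rfl | hw0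
    · simp
    have hpos : 0 < ‖w‖ := norm_pos_iff.2 hw0
    have : κ ≤ RCLike.re ⟪(L : T →ₗ[ℝ] T) ⟨w, (hT w).2 hw⟩, ⟨w, (hT w).2 hw⟩⟫_ℝ / ‖w‖ ^ 2 := by
      refine ciInf_le ⟨-‖L‖, ?_⟩ (⟨⟨w, (hT w).2 hw⟩, by simpa using hw0⟩ : { x : T // x ≠ 0 })
      rintro _ ⟨x, rfl⟩
      exact neg_le_of_abs_le (L.rayleighQuotient_le_norm x)
    rw [le_div_iff₀ (by positivity)] at this
    exact this.trans_eq (hLin _ _)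

/-- On the segment, subtracting `c/2 ‖y - x‖² a²` leaves a function with monotone derivative, hence
convex; it is compared at `a = 0, 1/2, 1`. -/
theorem midpoint_le_of_stronglyMonotone {F : Type*} [NormedAddCommGroup F] [NormedSpace ℝ F]
    {f : F → ℝ} {f' : F → F →L[ℝ] ℝ} {s : Set F} {c : ℝ} (hs : Convex ℝ s)
    (hf : ∀ x ∈ s, HasFDerivAt f (f' x) x)
    (hmono : ∀ x ∈ s, ∀ y ∈ s, c * ‖x - y‖ ^ 2 ≤ (f' x - f' y) (x - y)) {x y : F}
    (hx : x ∈ s) (hy : y ∈ s) :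
    f (midpoint ℝ x y) ≤ (f x + f y) / 2 - c / 8 * ‖x - y‖ ^ 2 := by
  set d := y - x with hd
  have hmem : ∀ a ∈ Set.Icc (0 : ℝ) 1, x + a • d ∈ s := fun a ha =>
    hs.add_smul_sub_mem hx hy ha
  let φ : ℝ → ℝ := fun a => f (x + a • d) - c / 2 * ‖d‖ ^ 2 * a ^ 2
  have hφ : ∀ a ∈ Set.Icc (0 : ℝ) 1,
      HasDerivAt φ (f' (x + a • d) d - c / 2 * ‖d‖ ^ 2 * (2 * a)) a := fun a ha => by
    have h1 : HasDerivAt (fun a : ℝ => x + a • d) d a := by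
      simpa using ((hasDerivAt_id a).smul_const d).const_add x
    have h2 := (hf _ (hmem a ha)).comp_hasDerivAt a h1
    have h3 : HasDerivAt (fun a : ℝ => a ^ 2) (2 * a) a := by simpa using hasDerivAt_pow 2 a
    exact h2.sub (h3.const_mul _)
  have hconv : ConvexOn ℝ (Set.Icc (0 : ℝ) 1) φ := by
    refine MonotoneOn.convexOn_of_deriv (convex_Icc 0 1)
      (fun a ha => (hφ a ha).continuousAt.continuousWithinAt)
      (fun a ha => (hφ a (interior_subset ha)).differentiableAt.differentiableWithinAt) ?_
    intro a ha b hb hab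
    have ha := interior_subset ha
    have hb := interior_subset hb
    rw [(hφ a ha).deriv, (hφ b hb).deriv]
    rcases hab.eq_or_lt with rfl | hab
    · rfl
    have h1 := hmono _ (hmem b hb) _ (hmem a ha)
    have h2 : x + b • d - (x + a • d) = (b - a) • d := by rw [sub_smul]; abel
    rw [h2, norm_smul, map_smul, smul_eq_mul, mul_pow, Real.norm_eq_abs, sq_abs,
      sub_apply] at h1
    have h3 : (b - a) * (c * (b - a) * ‖d‖ ^ 2) ≤ (b - a) * (f' (x + b • d) d - f' (x + a • d) d) := by
      linarith
    have h4 := le_of_mul_le_mul_left h3 (sub_pos.2 hab)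
    linarith
  have h := hconv.2 (Set.left_mem_Icc.2 zero_le_one) (Set.right_mem_Icc.2 zero_le_one)
    (by norm_num : (0 : ℝ) ≤ 1 / 2) (by norm_num : (0 : ℝ) ≤ 1 / 2) (by norm_num)
  have hmid : x + (1 / 2 : ℝ) • d = midpoint ℝ x y := by
    rw [midpoint_eq_smul_add, hd, invOf_eq_inv]
    module
  have hxd : x + d = y := by rw [hd]; abel
  simp only [φ, smul_eq_mul, mul_zero, mul_one, zero_add, zero_smul, one_smul, add_zero, hmid, hxd]
    at h
  rw [norm_sub_rev x y, ← hd]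
  nlinarith

theorem inner_gradient {n : ℕ} (ρ : E n → ℝ) (x w : E n) :
    ⟪gradient ρ x, w⟫_ℝ = fderiv ℝ ρ x w := by
  rw [← toDual_gradient, InnerProductSpace.toDual_apply_apply]

theorem gradient_eq_comp {n : ℕ} (ρ : E n → ℝ) :
    gradient ρ = fun x => (InnerProductSpace.toDual ℝ (E n)).symm (fderiv ℝ ρ x) := rfl

theorem eventually_pos_of_hasDerivAt {f : ℝ → ℝ} {f' : ℝ} (hf : HasDerivAt f f' 0) (h0 : f 0 = 0)
    (hf' : 0 < f') : ∀ᶠ s in 𝓝[>] 0, 0 < f s := by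
  have h := (hasDerivAt_iff_tendsto_slope.1 hf).mono_left
    (nhdsWithin_mono 0 (fun x (hx : (0 : ℝ) < x) => hx.ne'))
  filter_upwards [h.eventually (lt_mem_nhds hf'), self_mem_nhdsWithin] with s hs (hs0 : 0 < s)
  rw [slope_def_field, h0, sub_zero, sub_zero] at hs
  exact (div_pos_iff_of_pos_right hs0).1 hs

/-! ### Local defining functions and the Weingarten map -/

namespace IsLocalDefining

variable {n : ℕ} {K : Set (E n)} {p : E n} {W : Set (E n)} {ρ : E n → ℝ}

theorem contDiffAt (h : IsLocalDefining K p W ρ) {x : E n} (hx : x ∈ W) : ContDiffAt ℝ 2 ρ x :=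
  h.contDiffOn.contDiffAt (h.isOpen.mem_nhds hx)

theorem differentiableAt (h : IsLocalDefining K p W ρ) {x : E n} (hx : x ∈ W) :
    DifferentiableAt ℝ ρ x :=
  (h.contDiffAt hx).differentiableAt (by norm_num)

theorem apply_eq_zero (h : IsLocalDefining K p W ρ) : ρ p = 0 :=
  (h.frontier_iff p h.mem).1 h.mem_frontier

theorem nonpos (h : IsLocalDefining K p W ρ) {x : E n} (hx : x ∈ W) (hxK : x ∈ K) : ρ x ≤ 0 := by
  by_cases hi : x ∈ interior K
  · exact (h.neg_interior x hx hi).le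
  · exact ((h.frontier_iff x hx).1 ⟨subset_closure hxK, hi⟩).le

theorem hasDerivAt_line (h : IsLocalDefining K p W ρ) (w : E n) :
    HasDerivAt (fun s : ℝ => ρ (p + s • w)) (fderiv ℝ ρ p w) 0 := by
  have h1 : HasDerivAt (fun s : ℝ => p + s • w) w 0 := by
    simpa using ((hasDerivAt_id (0 : ℝ)).smul_const w).const_add p
  have h2 : HasFDerivAt ρ (fderiv ℝ ρ p) (p + (0 : ℝ) • w) := by
    simpa using (h.differentiableAt h.mem).hasFDerivAt
  exact h2.comp_hasDerivAt 0 h1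

/-- Segments from `p` to interior points run inside the interior, where `ρ < 0`, which gives `≤ 0`.
Strictness follows by moving `z` slightly along the gradient. -/
theorem fderiv_sub_neg (h : IsLocalDefining K p W ρ) (hK : Convex ℝ K) {z : E n}
    (hz : z ∈ interior K) : fderiv ℝ ρ p (z - p) < 0 := by
  have hp : p ∈ closure K := frontier_subset_closure h.mem_frontier
  have hle : ∀ y ∈ interior K, fderiv ℝ ρ p (y - p) ≤ 0 := fun y hy => by
    by_contra! hpos
    have h1 := eventually_pos_of_hasDerivAt (h.hasDerivAt_line (y - p))
      (by simpa using h.apply_eq_zero) hpos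
    have hc : Tendsto (fun s : ℝ => p + s • (y - p)) (𝓝[>] 0) (𝓝 p) := by
      have : Continuous (fun s : ℝ => p + s • (y - p)) := by fun_prop
      simpa using (this.tendsto 0).mono_left nhdsWithin_le_nhds
    obtain ⟨s, hs1, hs2, hs3⟩ := (h1.and ((hc.eventually (h.isOpen.mem_nhds h.mem)).and
      (Ioo_mem_nhdsGT one_pos))).exists
    refine absurd (h.neg_interior _ hs2 ?_) hs1.not_gt
    exact hK.add_smul_sub_mem_interior' hp hy ⟨hs3.1, hs3.2.le⟩
  have hc : Tendsto (fun s : ℝ => z + s • gradient ρ p) (𝓝[>] 0) (𝓝 z) := by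
    have : Continuous (fun s : ℝ => z + s • gradient ρ p) := by fun_prop
    simpa using (this.tendsto 0).mono_left nhdsWithin_le_nhds
  obtain ⟨s, hs, hs0⟩ := ((hc.eventually (isOpen_interior.mem_nhds hz)).and
    self_mem_nhdsWithin).exists
  have h2 := hle _ hs
  have h3 : 0 < ‖gradient ρ p‖ := norm_pos_iff.2 (h.gradient_ne_zero p h.mem)
  rw [add_sub_right_comm, map_add, map_smul, ← inner_gradient ρ p (gradient ρ p),
    real_inner_self_eq_norm_sq, smul_eq_mul] at h2
  have : 0 < s * ‖gradient ρ p‖ ^ 2 := mul_pos hs0 (by positivity)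
  linarith

/-- Moving `x` backwards along `w = z - p`, with `z` interior, makes `ρ` positive, so a boundary
point `y = x - s • w` is crossed. As `y + w` is close to `z`, it lies in `K`, and `x` lies on the
segment from `y` to `y + w`. -/
theorem eventually_mem_of_nonpos (h : IsLocalDefining K p W ρ) (hK : IsSymmConvexBody K) :
    ∀ᶠ x in 𝓝 p, ρ x ≤ 0 → x ∈ K := by
  obtain ⟨z, hz⟩ := hK.interior_nonempty
  set w := z - p with hw
  obtain ⟨η, hη, hηK⟩ := Metric.isOpen_iff.1 isOpen_interior z hz
  obtain ⟨R, hR, hRW⟩ := Metric.isOpen_iff.1 h.isOpen p h.mem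
  set m := min η R with hm
  have hm0 : 0 < m := lt_min hη hR
  have hpos := eventually_pos_of_hasDerivAt (h.hasDerivAt_line (-w))
    (by simpa using h.apply_eq_zero)
    (by rw [map_neg, neg_pos]; exact h.fderiv_sub_neg hK.convex hz)
  have hsmall : ∀ᶠ s : ℝ in 𝓝[>] 0, s * ‖w‖ < m / 2 := by
    have : Continuous (fun s : ℝ => s * ‖w‖) := by fun_prop
    have := (this.tendsto 0).mono_left (nhdsWithin_le_nhds (s := Set.Ioi 0))
    rw [zero_mul] at this
    exact this.eventually (gt_mem_nhds (by positivity))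
  obtain ⟨δ, hδρ, hδm, hδ0, hδ1⟩ :=
    (hpos.and (hsmall.and (Ioo_mem_nhdsGT one_pos))).exists
  have hball : ∀ x ∈ Metric.ball p (m / 2), ∀ s ∈ Set.Icc 0 δ, ‖x + s • (-w) - p‖ < m := by
    intro x hx s hs
    rw [mem_ball_iff_norm] at hx
    calc ‖x + s • (-w) - p‖ = ‖(x - p) - s • w‖ := by congr 1; rw [smul_neg]; abel
      _ ≤ ‖x - p‖ + ‖s • w‖ := norm_sub_le _ _
      _ = ‖x - p‖ + s * ‖w‖ := by rw [norm_smul, Real.norm_of_nonneg hs.1]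
      _ ≤ ‖x - p‖ + δ * ‖w‖ := by gcongr; exact hs.2
      _ < m := by linarith
  have hballW : ∀ x ∈ Metric.ball p (m / 2), ∀ s ∈ Set.Icc 0 δ, x + s • (-w) ∈ W :=
    fun x hx s hs => hRW (mem_ball_iff_norm.2 ((hball x hx s hs).trans_le (min_le_right _ _)))
  have hcont : ∀ᶠ x in 𝓝 p, 0 < ρ (x + δ • (-w)) := by
    have h1 : ContinuousAt ρ (p + δ • (-w)) := (h.differentiableAt
      (hballW p (Metric.mem_ball_self (by positivity)) δ ⟨hδ0.le, le_rfl⟩)).continuousAt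
    have h2 : ContinuousAt (fun x => ρ (x + δ • (-w))) p :=
      ContinuousAt.comp (f := fun x => x + δ • (-w)) h1 (by fun_prop)
    exact h2.eventually (lt_mem_nhds hδρ)
  filter_upwards [hcont, Metric.ball_mem_nhds p (half_pos hm0)] with x hx hxm hρ
  obtain ⟨s, hs, hs0⟩ : (0 : ℝ) ∈ (fun s : ℝ => ρ (x + s • (-w))) '' Set.Icc 0 δ := by
    refine intermediate_value_Icc hδ0.le (fun s hs => ?_) ⟨by simpa using hρ, hx.le⟩
    have h1 := (h.differentiableAt (hballW x hxm s hs)).continuousAt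
    exact (ContinuousAt.comp (f := fun s : ℝ => x + s • (-w)) h1
      (by fun_prop)).continuousWithinAt
  set y := x + s • (-w) with hy
  have hyK : y ∈ K := hK.isCompact.isClosed.frontier_subset
    ((h.frontier_iff y (hballW x hxm s hs)).2 hs0)
  have hyw : y + w ∈ K := by
    refine interior_subset (hηK (mem_ball_iff_norm.2 ?_))
    have : y + w - z = y - p := by rw [hw]; abel
    rw [this]
    exact (hball x hxm s hs).trans_le (min_le_left _ _)
  have := hK.convex.add_smul_mem hyK hyw (t := s) ⟨hs.1, hs.2.trans hδ1.le⟩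
  rwa [hy, smul_neg, neg_add_cancel_right] at this

/-- The derivative of the unit normal is, modulo the normal direction and the factor `‖∇ρ‖⁻¹`,
the Hessian; and it takes values orthogonal to the normal direction. -/
theorem fderiv_unitNormal_eq (h : IsLocalDefining K p W ρ) {w : E n} {κ : ℝ}
    (hw : ⟪gradient ρ p, w⟫_ℝ = 0)
    (hH : fderiv ℝ (gradient ρ) p w - κ • w ∈ Submodule.span ℝ {gradient ρ p}) :
    fderiv ℝ (unitNormal ρ) p w = (‖gradient ρ p‖⁻¹ * κ) • w := by
  set g := gradient ρ p with hg
  have hg0 : g ≠ 0 := h.gradient_ne_zero p h.mem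
  have hG : DifferentiableAt ℝ (gradient ρ) p := by
    have : ContDiffAt ℝ 1 (fderiv ℝ ρ) p := (h.contDiffAt h.mem).fderiv_right (by norm_num)
    rw [gradient_eq_comp]
    exact (InnerProductSpace.toDual ℝ (E n)).symm.toContinuousLinearEquiv.differentiableAt.comp p
      (this.differentiableAt (by norm_num))
  have hN : DifferentiableAt ℝ (fun x => ‖gradient ρ x‖⁻¹) p :=
    (hG.norm ℝ hg0).inv (norm_ne_zero_iff.2 hg0)
  have hfd : HasFDerivAt (unitNormal ρ) _ p := hN.hasFDerivAt.smul hG.hasFDerivAt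
  set ν' := fderiv ℝ (unitNormal ρ) p w with hν'
  obtain ⟨a, ha⟩ := Submodule.mem_span_singleton.1 hH
  have h1 : ∃ b : ℝ, ν' = (‖g‖⁻¹ * κ) • w + b • g := by
    refine ⟨‖g‖⁻¹ * a + fderiv ℝ (fun x => ‖gradient ρ x‖⁻¹) p w, ?_⟩
    have h2 : fderiv ℝ (gradient ρ) p w = κ • w + a • g := by rw [ha]; abel
    rw [hν', hfd.fderiv]
    simp only [add_apply, smul_apply, ContinuousLinearMap.smulRight_apply]
    rw [h2]
    module
  obtain ⟨b, hb⟩ := h1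
  -- Differentiating `‖unitNormal ρ‖² = 1` shows that the normal component `b` vanishes.
  have hperp : ⟪unitNormal ρ p, ν'⟫_ℝ = 0 := by
    have h2 : (fun x => ⟪unitNormal ρ x, unitNormal ρ x⟫_ℝ) =ᶠ[𝓝 p] fun _ => (1 : ℝ) := by
      filter_upwards [h.isOpen.mem_nhds h.mem] with x hx
      have := norm_ne_zero_iff.2 (h.gradient_ne_zero x hx)
      rw [real_inner_self_eq_norm_sq, unitNormal, norm_smul, norm_inv, norm_norm,
        inv_mul_cancel₀ this, one_pow]
    have h3 := hfd.differentiableAt.hasFDerivAt.inner ℝ hfd.differentiableAt.hasFDerivAt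
    have h4 := (h3.congr_of_eventuallyEq h2.symm).unique (hasFDerivAt_const (1 : ℝ) p)
    have h5 := congrArg (fun L => L w) h4
    simp [fderivInnerCLM_apply] at h5
    rw [real_inner_comm] at h5
    linarith [h5, real_inner_comm (unitNormal ρ p) ν']
  have hgν : ⟪g, ν'⟫_ℝ = 0 := by
    rw [unitNormal, inner_smul_left, ← hg] at hperp
    simpa [hg0] using hperp
  rw [hb, inner_add_right, inner_smul_right, inner_smul_right, hw, mul_zero, zero_add,
    real_inner_self_eq_norm_sq] at hgν
  have hb0 : b = 0 := by simpa [hg0] using hgν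
  rw [hb, hb0, zero_smul, add_zero]

end IsLocalDefining

/-! ### Uniform convexity from positive curvature -/

/-- Quantitative local uniform convexity of `K` near `p`. -/
def UniformlyConvexNear {n : ℕ} (K : Set (E n)) (p : E n) (r c : ℝ) : Prop :=
  ∀ X ∈ K, ∀ Y ∈ K, X ∈ Metric.ball p r → Y ∈ Metric.ball p r →
    Metric.closedBall (midpoint ℝ X Y) (c * ‖X - Y‖ ^ 2) ⊆ K

theorem UniformlyConvexNear.neg {n : ℕ} {K : Set (E n)} (hK : -K = K) {p : E n} {r c : ℝ}
    (h : UniformlyConvexNear K p r c) : UniformlyConvexNear K (-p) r c := by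
  have hmem : ∀ x, -x ∈ K ↔ x ∈ K := fun x => by rw [← Set.mem_neg, hK]
  intro X hX Y hY hXp hYp Z hZ
  rw [← hmem]
  refine h (-X) ((hmem X).2 hX) (-Y) ((hmem Y).2 hY) ?_ ?_ ?_
  · rwa [mem_ball_iff_norm, ← norm_neg, neg_sub', neg_neg, ← mem_ball_iff_norm]
  · rwa [mem_ball_iff_norm, ← norm_neg, neg_sub', neg_neg, ← mem_ball_iff_norm]
  · rw [mem_closedBall_iff_norm] at hZ ⊢
    have h1 : -Z - midpoint ℝ (-X) (-Y) = -(Z - midpoint ℝ X Y) := by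
      simp only [midpoint_eq_smul_add]; module
    have h2 : -X - -Y = -(X - Y) := by abel
    rwa [h1, h2, norm_neg, norm_neg]

namespace IsLocalDefining

variable {n : ℕ} {K : Set (E n)} {p : E n} {W : Set (E n)} {ρ : E n → ℝ}

/-- An eigenvalue of the Hessian compressed to the tangent space is `‖∇ρ‖` times a principal
curvature, hence positive. -/
theorem exists_hessian_coercive (h : IsLocalDefining K p W ρ)
    (hcurv : ∀ κ : ℝ, IsPrincipalCurvature K p κ → 0 < κ) :
    ∃ A : ℝ, 0 ≤ A ∧ ∃ c : ℝ, 0 < c ∧ ∀ w, c * ‖w‖ ^ 2 ≤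
      fderiv ℝ (fderiv ℝ ρ) p w w + A * (fderiv ℝ ρ p w) ^ 2 := by
  have hD : DifferentiableAt ℝ (fderiv ℝ ρ) p :=
    ((h.contDiffAt h.mem).fderiv_right (m := 1) (by norm_num)).differentiableAt (by norm_num)
  set H := fderiv ℝ (gradient ρ) p with hH
  have hin : ∀ x y, ⟪H x, y⟫_ℝ = fderiv ℝ (fderiv ℝ ρ) p x y := fun x y => by
    have h1 : HasFDerivAt (gradient ρ) _ p :=
      ((InnerProductSpace.toDual ℝ (E n)).symm.toContinuousLinearEquiv.hasFDerivAt).comp p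
        hD.hasFDerivAt
    rw [hH, h1.fderiv]
    exact InnerProductSpace.toDual_symm_apply
  have hsymm : ∀ x y, ⟪H x, y⟫_ℝ = ⟪x, H y⟫_ℝ := fun x y => by
    rw [hin, real_inner_comm, hin]
    exact (h.contDiffAt h.mem).isSymmSndFDerivAt (by simp) x y
  have hg := h.gradient_ne_zero p h.mem
  obtain ⟨κ, hκ, hκH⟩ := exists_coercive_on_orthogonal H hsymm (gradient ρ p)
    (fun κ w hw hgw hspan => by
      have := hcurv _ ⟨W, ρ, h, w, hw, hgw, h.fderiv_unitNormal_eq hgw hspan⟩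
      exact (pos_iff_pos_of_mul_pos this).1 (inv_pos.2 (norm_pos_iff.2 hg)))
  obtain ⟨A, hA, c, hc, hw⟩ := exists_coercive_add_inner_sq H hg hκ hκH
  refine ⟨A, hA, c, hc, fun w => ?_⟩
  rw [← hin, ← inner_gradient]
  exact hw w

/-- A boundary point with positive principal curvatures has a neighbourhood in which `K` is
uniformly convex. -/
theorem exists_uniformlyConvexNear (h : IsLocalDefining K p W ρ) (hK : IsSymmConvexBody K)
    (hcurv : ∀ κ : ℝ, IsPrincipalCurvature K p κ → 0 < κ) :
    ∃ r : ℝ, 0 < r ∧ ∃ c : ℝ, 0 < c ∧ UniformlyConvexNear K p r c := by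
  obtain ⟨A, hA, c, hc, hHess⟩ := h.exists_hessian_coercive hcurv
  -- Near `p`, `σ` has the sign of `ρ`, but its Hessian at `p` is `D²ρ + A (Dρ)²`, coercive in all
  -- directions.
  let σ : E n → ℝ := fun x => ρ x + A / 2 * ρ x ^ 2
  let σ' : E n → E n →L[ℝ] ℝ := fun x => (1 + A * ρ x) • fderiv ℝ ρ x
  have hσ : ∀ x ∈ W, HasFDerivAt σ (σ' x) x := fun x hx => by
    have h1 := (h.differentiableAt hx).hasFDerivAt
    have h2 := h1.add ((h1.pow 2).const_mul (A / 2))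
    refine h2.congr_fderiv ?_
    ext w
    simp [σ']
    ring
  -- Strict differentiability at `p` compares `σ'` at two nearby points, so coercivity at `p` alone
  -- yields strong monotonicity near `p`.
  have hσ' : HasStrictFDerivAt σ' _ p :=
    (((h.contDiffAt h.mem).hasStrictFDerivAt (by norm_num)).const_mul A |>.const_add 1).smul
      (((h.contDiffAt h.mem).fderiv_right (m := 1) (by norm_num)).hasStrictFDerivAt (by norm_num))
  have hmono : ∀ᶠ xy : E n × E n in 𝓝 (p, p),
      c / 2 * ‖xy.1 - xy.2‖ ^ 2 ≤ (σ' xy.1 - σ' xy.2) (xy.1 - xy.2) := by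
    filter_upwards [hσ'.isLittleO.def (half_pos hc)] with xy hxy
    set w := xy.1 - xy.2 with hw
    have h1 := (ContinuousLinearMap.le_opNorm _ w).trans
      (mul_le_mul_of_nonneg_right hxy (norm_nonneg w))
    rw [Real.norm_eq_abs] at h1
    have h2 := neg_le_of_abs_le h1
    have h3 := hHess w
    simp [h.apply_eq_zero] at h2
    rw [sub_apply]
    nlinarith
  have hσC : ContDiffAt ℝ 1 σ p := by
    have := (h.contDiffAt h.mem).of_le (m := 1) (by norm_num)
    exact this.add (contDiffAt_const.mul (this.pow 2))
  obtain ⟨L, s, hs, hL⟩ := hσC.exists_lipschitzOnWith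
  have hsmall : ∀ᶠ x in 𝓝 p, 0 < 1 + A / 2 * ρ x := by
    have h1 : ContinuousAt (fun x => 1 + A / 2 * ρ x) p :=
      continuousAt_const.add (continuousAt_const.mul (h.differentiableAt h.mem).continuousAt)
    refine h1.eventually (lt_mem_nhds ?_)
    simp [h.apply_eq_zero]
  rw [nhds_prod_eq] at hmono
  obtain ⟨P, hP, hPP⟩ := eventually_prod_self_iff
    (r := fun x y => c / 2 * ‖x - y‖ ^ 2 ≤ (σ' x - σ' y) (x - y)) |>.1 hmono
  obtain ⟨R, hR, hball⟩ := Metric.eventually_nhds_iff_ball.1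
    ((h.eventually_mem_of_nonpos hK).and (hsmall.and (inter_mem (h.isOpen.mem_nhds h.mem)
      (inter_mem hs hP) : ∀ᶠ x in 𝓝 p, x ∈ W ∧ x ∈ s ∧ x ∈ P)))
  obtain ⟨L', hL'0, hL'⟩ : ∃ L' : ℝ, 0 < L' ∧ ∀ x ∈ s, ∀ y ∈ s, σ x - σ y ≤ L' * ‖x - y‖ := by
    refine ⟨L + 1, by positivity, fun x hx y hy => ?_⟩
    have h1 := hL.dist_le_mul x hx y hy
    rw [Real.dist_eq, dist_eq_norm] at h1
    nlinarith [le_abs_self (σ x - σ y), norm_nonneg (x - y)]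
  have hsig : ∀ x, σ x = (1 + A / 2 * ρ x) * ρ x := fun x => by simp only [σ]; ring
  -- The bound `1 / (2R)` keeps `Z` in the ball of radius `R`; `c / 16 / L'` keeps the Lipschitz
  -- growth of `σ` below its midpoint deficit `c / 16 ‖X - Y‖²`.
  refine ⟨R / 2, half_pos hR, min (c / 16 / L') (1 / (2 * R)), by positivity, ?_⟩
  intro X hX Y hY hXp hYp Z hZ
  have hsub : Metric.ball p (R / 2) ⊆ Metric.ball p R := Metric.ball_subset_ball (by linarith)
  have hmid : σ (midpoint ℝ X Y) ≤ (σ X + σ Y) / 2 - c / 2 / 8 * ‖X - Y‖ ^ 2 :=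
    midpoint_le_of_stronglyMonotone (convex_ball p R) (fun x hx => hσ x (hball x hx).2.2.1)
      (fun x hx y hy => hPP _ (hball x hx).2.2.2.2 _ (hball y hy).2.2.2.2) (hsub hXp) (hsub hYp)
  have hneg : ∀ x ∈ Metric.ball p R, x ∈ K → σ x ≤ 0 := fun x hx hxK => by
    rw [hsig]
    exact mul_nonpos_of_nonneg_of_nonpos (hball x hx).2.1.le (h.nonpos (hball x hx).2.2.1 hxK)
  have hMp : midpoint ℝ X Y ∈ Metric.ball p (R / 2) :=
    (convex_ball p (R / 2)).midpoint_mem hXp hYp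
  rw [mem_closedBall_iff_norm] at hZ
  have hd : ‖X - Y‖ < R := by
    have h1 : ‖X - Y‖ ≤ ‖X - p‖ + ‖Y - p‖ := by
      simpa using norm_sub_le (X - p) (Y - p)
    rw [mem_ball_iff_norm] at hXp hYp
    linarith
  have hZp : Z ∈ Metric.ball p R := by
    rw [mem_ball_iff_norm] at hMp ⊢
    have h1 : ‖Z - midpoint ℝ X Y‖ ≤ R / 2 := by
      refine hZ.trans ?_
      calc min (c / 16 / L') (1 / (2 * R)) * ‖X - Y‖ ^ 2 ≤ 1 / (2 * R) * R ^ 2 := by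
            gcongr
            exact min_le_right _ _
        _ = R / 2 := by field_simp
    have h2 : ‖Z - p‖ ≤ ‖Z - midpoint ℝ X Y‖ + ‖midpoint ℝ X Y - p‖ := by
      simpa using norm_add_le (Z - midpoint ℝ X Y) (midpoint ℝ X Y - p)
    linarith
  refine (hball Z hZp).1 ?_
  have h1 := hL' Z (hball Z hZp).2.2.2.1 _ (hball _ (hsub hMp)).2.2.2.1
  have h2 : L' * ‖Z - midpoint ℝ X Y‖ ≤ c / 16 * ‖X - Y‖ ^ 2 := by
    calc L' * ‖Z - midpoint ℝ X Y‖ ≤ L' * (c / 16 / L' * ‖X - Y‖ ^ 2) := by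
          gcongr
          exact hZ.trans (mul_le_mul_of_nonneg_right (min_le_left _ _) (by positivity))
      _ = c / 16 * ‖X - Y‖ ^ 2 := by field_simp
  have h3 : σ Z ≤ 0 := by linarith [hneg X (hsub hXp) hX, hneg Y (hsub hYp) hY]
  rw [hsig] at h3
  exact nonpos_of_mul_nonpos_right h3 (hball Z hZp).2.1

end IsLocalDefining

/-! ### A second boundary point -/

/-- A connected set that meets the interior and the complement of a set meets its frontier. -/
theorem _root_.IsPreconnected.exists_mem_frontier {X : Type*} [TopologicalSpace X] {S K : Set X}
    (hS : IsPreconnected S) {a b : X} (ha : a ∈ S) (haK : a ∈ interior K) (hb : b ∈ S)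
    (hbK : b ∉ closure K) : ∃ q ∈ S, q ∈ frontier K := by
  by_contra! hno
  obtain ⟨x, -, hx1, hx2⟩ := hS (interior K) (closure K)ᶜ isOpen_interior
    isClosed_closure.isOpen_compl
    (fun x hx => by
      by_contra hcon
      rw [Set.mem_union, not_or, Set.mem_compl_iff, not_not] at hcon
      exact hno x hx ⟨hcon.2, hcon.1⟩)
    ⟨a, ha, haK⟩ ⟨b, hb, hbK⟩
  exact hx2 (subset_closure (interior_subset hx1))

/-- In dimension at least two, small spheres about a frontier point of a convex body meet the
frontier again. -/
theorem exists_mem_frontier_norm_sub_eq {n : ℕ} (hn : 2 ≤ n) {K : Set (E n)} (hK : Convex ℝ K)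
    {z p : E n} (hz : z ∈ interior K) (hp : p ∈ frontier K) {ε : ℝ}
    (hε : 0 < ε) (hεz : ε ≤ ‖z - p‖) : ∃ q ∈ frontier K, ‖q - p‖ = ε := by
  have hzp : 0 < ‖z - p‖ := hε.trans_le hεz
  set s := ε / ‖z - p‖ with hs
  have hs0 : 0 < s := by positivity
  have hs1 : s ≤ 1 := (div_le_one hzp).2 hεz
  have hnorm : ‖s • (z - p)‖ = ε := by
    rw [norm_smul, Real.norm_of_nonneg hs0.le, hs]; field_simp
  have hrank : 1 < Module.rank ℝ (E n) := by
    rw [← Module.finrank_eq_rank, finrank_euclideanSpace_fin]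
    exact_mod_cast hn
  have ha : p + s • (z - p) ∈ interior K :=
    hK.add_smul_sub_mem_interior' (frontier_subset_closure hp) hz ⟨hs0, hs1⟩
  -- Otherwise `p` would be the midpoint of a point of the closure and an interior point, hence
  -- interior.
  have hb : p + -(s • (z - p)) ∉ closure K := fun hb => by
    refine hp.2 ?_
    have h1 := hK.add_smul_sub_mem_interior' hb ha (t := 1 / 2) ⟨by norm_num, by norm_num⟩
    convert h1 using 1
    module
  obtain ⟨q, hq, hqK⟩ := (isConnected_sphere hrank p hε.le).isPreconnected.exists_mem_frontier
    (a := p + s • (z - p)) (b := p + -(s • (z - p)))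
    (by simpa using hnorm) ha (by simpa using hnorm) hb
  exact ⟨q, hqK, by simpa [dist_eq_norm] using hq⟩

/-! ### Perturbing concave functions -/

section Perturbation

variable {V : Type*} [NormedAddCommGroup V] [NormedSpace ℝ V] {C : Set V} {g : V → ℝ}

/-- A concave function has a supergradient, relative to a segment, at each interior point of the
segment. -/
theorem exists_supergradient_segment (hg : ConcaveOn ℝ C g) {x y z : V} (hx : x ∈ C) (hy : y ∈ C)
    {a b : ℝ} (ha : 0 < a) (hb : 0 < b) (hab : a + b = 1) (hz : a • x + b • y = z) :
    ∃ α : ℝ, ∀ s ∈ Set.Icc (0 : ℝ) 1, g (z + s • (y - z)) ≤ g z + α * a * s ∧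
      g (z + s • (x - z)) ≤ g z - α * b * s := by
  have hzC : z ∈ C := hz ▸ hg.1 hx hy ha.le hb.le hab
  let A : Set ℝ := (fun s : ℝ => (g (z + s • (y - z)) - g z) / (a * s)) '' Set.Ioc 0 1
  let B : Set ℝ := (fun s : ℝ => (g z - g (z + s • (x - z))) / (b * s)) '' Set.Ioc 0 1
  have hyz : y - z = a • (y - x) := by
    rw [← hz, ← eq_sub_iff_add_eq'] at *
    subst hab
    module
  have hxz : x - z = -(b • (y - x)) := by
    rw [← hz, ← eq_sub_iff_add_eq] at *
    subst hab
    module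
  -- `A` and `B` hold the slopes on the two sides of `z`, per unit of `y - x`; concavity puts every
  -- element of `A` below every element of `B`.
  obtain ⟨α, hαA, hαB⟩ : (upperBounds A ∩ lowerBounds B).Nonempty := by
    refine exists_between_of_forall_le (Set.Nonempty.image _ ⟨1, by simp⟩)
      (Set.Nonempty.image _ ⟨1, by simp⟩) ?_
    rintro _ ⟨s, hs, rfl⟩ _ ⟨t, ht, rfl⟩
    have has : 0 < a * s := mul_pos ha hs.1
    have hbt : 0 < b * t := mul_pos hb ht.1
    have h1 := hg.2 (hg.1.add_smul_sub_mem hzC hy ⟨hs.1.le, hs.2⟩)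
      (hg.1.add_smul_sub_mem hzC hx ⟨ht.1.le, ht.2⟩)
      (show 0 ≤ b * t / (a * s + b * t) by positivity)
      (show 0 ≤ a * s / (a * s + b * t) by positivity) (by field_simp; ring)
    have h2 : (b * t / (a * s + b * t)) • (z + s • (y - z)) +
        (a * s / (a * s + b * t)) • (z + t • (x - z)) = z := by
      rw [hyz, hxz]
      have h3 : b * t / (a * s + b * t) = 1 - a * s / (a * s + b * t) := by field_simp; ring
      have h4 : (b * t / (a * s + b * t)) * (s * a) - (a * s / (a * s + b * t)) * (t * b) = 0 := by
        field_simp; ring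
      calc _ = ((b * t / (a * s + b * t)) + (a * s / (a * s + b * t))) • z +
            ((b * t / (a * s + b * t)) * (s * a) - (a * s / (a * s + b * t)) * (t * b)) • (y - x) := by
              module
        _ = z := by rw [h4, h3]; simp
    rw [h2, smul_eq_mul, smul_eq_mul, div_mul_eq_mul_div, div_mul_eq_mul_div, ← add_div,
      div_le_iff₀ (by positivity)] at h1
    change (g (z + s • (y - z)) - g z) / (a * s) ≤ (g z - g (z + t • (x - z))) / (b * t)
    rw [div_le_div_iff₀ has hbt]
    linarith
  refine ⟨α, fun s hs => ?_⟩
  rcases hs.1.eq_or_lt with rfl | hs0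
  · simp
  have h1 := hαA ⟨s, ⟨hs0, hs.2⟩, rfl⟩
  have h2 := hαB ⟨s, ⟨hs0, hs.2⟩, rfl⟩
  rw [div_le_iff₀ (by positivity)] at h1
  rw [le_div_iff₀ (by positivity)] at h2
  constructor <;> linarith

/-- If `g` is concave, and midpoint strongly concave at distance at most `r` of an endpoint, then a
supergradient of `g` at `z` along `[z, y]` can be improved by a quadratic term. -/
theorem le_supergradient_sub_sq (hg : ConcaveOn ℝ C g) {S : Set V} {r c D : ℝ} (hr : 0 < r)
    (hc : 0 < c) (hD : 0 < D)
    (hS : ∀ x ∈ S, ∀ y, x ∈ C → y ∈ C → ‖x - y‖ ≤ r →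
      (g x + g y) / 2 + c * ‖x - y‖ ^ 2 ≤ g (midpoint ℝ x y))
    {z y : V} (hz : z ∈ C) (hy : y ∈ C) (hyz : ‖y - z‖ ≤ D) (hzy : z ∈ S ∨ y ∈ S) {α : ℝ}
    (hα : ∀ s ∈ Set.Icc (0 : ℝ) 1, g (z + s • (y - z)) ≤ g z + α * s) :
    g y ≤ g z + α - c * min 1 (r / D) ^ 2 * ‖y - z‖ ^ 2 := by
  -- Strong concavity is known only up to distance `r`, so it is used on the portion `θ` of the
  -- segment adjacent to the endpoint in `S`; concavity carries the gain to `y`.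
  set θ := min 1 (r / D) with hθ
  have hθ0 : 0 < θ := lt_min one_pos (by positivity)
  have hθ1 : θ ≤ 1 := min_le_left _ _
  have hθr : θ * ‖y - z‖ ≤ r := by
    calc θ * ‖y - z‖ ≤ r / D * D := by gcongr; exact min_le_right _ _
      _ = r := by field_simp
  have hN : 0 ≤ c * θ ^ 2 * ‖y - z‖ ^ 2 := by positivity
  rcases hzy with hzS | hyS
  · have hw : z + θ • (y - z) ∈ C := hg.1.add_smul_sub_mem hz hy ⟨hθ0.le, hθ1⟩
    have hd : ‖z - (z + θ • (y - z))‖ = θ * ‖y - z‖ := by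
      rw [sub_add_cancel_left, norm_neg, norm_smul, Real.norm_of_nonneg hθ0.le]
    have h1 := hS z hzS _ hz hw (hd.trans_le hθr)
    rw [hd] at h1
    have hm : midpoint ℝ z (z + θ • (y - z)) = z + (θ / 2) • (y - z) := by
      rw [midpoint_eq_smul_add, invOf_eq_inv]; module
    have h2 := hα (θ / 2) ⟨by positivity, by linarith⟩
    rw [hm] at h1
    have h3 := hg.2 hz hy (show 0 ≤ 1 - θ by linarith) hθ0.le (by ring)
    have h4 : (1 - θ) • z + θ • y = z + θ • (y - z) := by module
    rw [h4, smul_eq_mul, smul_eq_mul] at h3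
    have h5 : θ * (g y - g z - α + c * θ ^ 2 * ‖y - z‖ ^ 2) ≤ 0 := by nlinarith
    have h6 := nonpos_of_mul_nonpos_right h5 hθ0
    linarith
  · have hw : z + (1 - θ) • (y - z) ∈ C :=
      hg.1.add_smul_sub_mem hz hy ⟨by linarith, by linarith⟩
    have hd : ‖y - (z + (1 - θ) • (y - z))‖ = θ * ‖y - z‖ := by
      have : y - (z + (1 - θ) • (y - z)) = θ • (y - z) := by module
      rw [this, norm_smul, Real.norm_of_nonneg hθ0.le]
    have h1 := hS y hyS _ hy hw (hd.trans_le hθr)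
    rw [hd] at h1
    have hm : midpoint ℝ y (z + (1 - θ) • (y - z)) = z + (1 - θ / 2) • (y - z) := by
      rw [midpoint_eq_smul_add, invOf_eq_inv]; module
    have h2 := hα (1 - θ / 2) ⟨by linarith, by linarith⟩
    rw [hm] at h1
    have h3 := hg.2 hz hy hθ0.le (show 0 ≤ 1 - θ by linarith) (by ring)
    have h4 : θ • z + (1 - θ) • y = z + (1 - θ) • (y - z) := by module
    rw [h4, smul_eq_mul, smul_eq_mul] at h3
    have h5 : (2 - θ) * (g y - g z - α + c * θ ^ 2 * ‖y - z‖ ^ 2) ≤ 0 := by nlinarith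
    have h6 := nonpos_of_mul_nonpos_right h5 (by linarith)
    linarith

/-- A bounded-domain concave function stays concave under small perturbations by functions with
Lipschitz derivative that are supported where the function is strongly concave. -/
theorem exists_concaveOn_add_mul (hg : ConcaveOn ℝ C g) {S : Set V} {r c D : ℝ} (hr : 0 < r)
    (hc : 0 < c) (hD : 0 < D) (hCD : ∀ x ∈ C, ∀ y ∈ C, ‖x - y‖ ≤ D)
    (hS : ∀ x ∈ S, ∀ y, x ∈ C → y ∈ C → ‖x - y‖ ≤ r →
      (g x + g y) / 2 + c * ‖x - y‖ ^ 2 ≤ g (midpoint ℝ x y))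
    {β : V → ℝ} {β' : V → V →L[ℝ] ℝ} {M : ℝ} (hM : 0 < M)
    (hβ : ∀ y z, |β y - β z - β' z (y - z)| ≤ M * ‖y - z‖ ^ 2)
    (hβS : ∀ x, x ∉ S → β x = 0 ∧ β' x = 0) :
    ∃ ε : ℝ, 0 < ε ∧ ∀ t ∈ Set.Ioo (-ε) ε, ConcaveOn ℝ C fun x => g x + t * β x := by
  set m := c * min 1 (r / D) ^ 2 with hm
  have hm0 : 0 < m := by
    have : 0 < min 1 (r / D) := lt_min one_pos (by positivity)
    positivity
  refine ⟨m / M, by positivity, fun t ht => ⟨hg.1, ?_⟩⟩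
  have htM : |t| * M ≤ m := by
    have := (abs_lt.2 ht).le
    rwa [le_div_iff₀ hM] at this
  -- The slope `α` corrected by `t * β' z` works for the perturbed function: the quadratic gain
  -- beats the Taylor error of `tβ`. If neither endpoint is in `S`, the perturbation is absent from
  -- the inequality, wherever the segment passes.
  have key : ∀ z ∈ C, ∀ y ∈ C, ∀ α : ℝ,
      (∀ s ∈ Set.Icc (0 : ℝ) 1, g (z + s • (y - z)) ≤ g z + α * s) →
      g y + t * β y ≤ g z + t * β z + (α + t * β' z (y - z)) := by
    intro z hz y hy α hα
    by_cases hzy : z ∈ S ∨ y ∈ S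
    · have h1 := le_supergradient_sub_sq hg hr hc hD hS hz hy (hCD y hy z hz) hzy hα
      have h2 : t * (β y - β z - β' z (y - z)) ≤ m * ‖y - z‖ ^ 2 := by
        calc t * (β y - β z - β' z (y - z)) ≤ |t * (β y - β z - β' z (y - z))| := le_abs_self _
          _ = |t| * |β y - β z - β' z (y - z)| := abs_mul _ _
          _ ≤ |t| * (M * ‖y - z‖ ^ 2) := by gcongr; exact hβ y z
          _ = |t| * M * ‖y - z‖ ^ 2 := by ring
          _ ≤ m * ‖y - z‖ ^ 2 := by gcongr
      linarith
    · rw [not_or] at hzy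
      have h1 := hα 1 ⟨zero_le_one, le_rfl⟩
      rw [one_smul, add_sub_cancel, mul_one] at h1
      rw [(hβS z hzy.1).1, (hβS z hzy.1).2, (hβS y hzy.2).1]
      simpa using h1
  intro x hx y hy a b ha hb hab
  rcases ha.eq_or_lt with rfl | ha
  · obtain rfl : b = 1 := by linarith
    simp
  rcases hb.eq_or_lt with rfl | hb
  · obtain rfl : a = 1 := by linarith
    simp
  set z := a • x + b • y with hz
  have hzC : z ∈ C := hg.1 hx hy ha.le hb.le hab
  obtain ⟨α, hα⟩ := exists_supergradient_segment hg hx hy ha hb hab rfl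
  have h1 := key z hzC y hy (α * a) fun s hs => (hα s hs).1
  have h2 := key z hzC x hx (-(α * b)) fun s hs => by linarith [(hα s hs).2]
  have h3 : a * β' z (x - z) + b * β' z (y - z) = 0 := by
    rw [← smul_eq_mul, ← smul_eq_mul, ← map_smul, ← map_smul, ← map_add]
    have : a • (x - z) + b • (y - z) = 0 := by
      have h4 : a • (x - z) + b • (y - z) = z - (a + b) • z := by rw [hz]; module
      rw [h4, hab, one_smul, sub_self]
    rw [this, map_zero]
  simp only [smul_eq_mul]
  have h4 : a * (g x + t * β x) + b * (g y + t * β y) ≤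
      a * (g z + t * β z + (-(α * b) + t * β' z (x - z))) +
      b * (g z + t * β z + (α * a + t * β' z (y - z))) :=
    add_le_add (mul_le_mul_of_nonneg_left h2 ha.le) (mul_le_mul_of_nonneg_left h1 hb.le)
  refine h4.trans_eq ?_
  linear_combination t * h3 + (g z + t * β z) * hab

end Perturbation

/-- Second order Taylor estimate for a compactly supported `C²` function. -/
theorem exists_taylor_bound {V : Type*} [NormedAddCommGroup V] [NormedSpace ℝ V]
    {φ : V → ℝ} (hφ : ContDiff ℝ 2 φ) (hs : HasCompactSupport φ) :
    ∃ M : ℝ, 0 < M ∧ ∀ y z, |φ y - φ z - fderiv ℝ φ z (y - z)| ≤ M * ‖y - z‖ ^ 2 := by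
  obtain ⟨L, hL⟩ := (hφ.fderiv_right (m := 1) (by norm_num)).lipschitzWith_of_hasCompactSupport
    (hs.fderiv ℝ) (by norm_num)
  refine ⟨L + 1, by positivity, fun y z => ?_⟩
  have h1 := (convex_segment z y).norm_image_sub_le_of_norm_hasFDerivWithin_le'
    (f := φ) (f' := fderiv ℝ φ) (φ := fderiv ℝ φ z) (C := (L + 1) * ‖y - z‖)
    (fun x _ => ((hφ.differentiable (by norm_num)) x).hasFDerivAt.hasFDerivWithinAt)
    (fun x hx => ?_) (left_mem_segment ℝ z y) (right_mem_segment ℝ z y)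
  · rw [Real.norm_eq_abs] at h1
    exact h1.trans_eq (by ring)
  · have h2 := hL.dist_le_mul x z
    rw [dist_eq_norm, dist_eq_norm] at h2
    have h3 : ‖x - z‖ ≤ ‖y - z‖ := norm_sub_le_of_mem_segment hx
    nlinarith [norm_nonneg (x - z), L.2]

/-! ### The upper height function and the moved bodies -/

section Top

variable {n : ℕ} {K : Set (E n)} {v : E n}

theorem IsSymmConvexBody.neg_mem_iff (hK : IsSymmConvexBody K) {x : E n} : -x ∈ K ↔ x ∈ K := by
  rw [← Set.mem_neg, hK.neg_eq]

theorem IsSymmConvexBody.neg_mem_interior (hK : IsSymmConvexBody K) {x : E n}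
    (hx : x ∈ interior K) : -x ∈ interior K := by
  have h : interior (-K) = -interior K := ((Homeomorph.neg (E n)).preimage_interior K).symm
  rw [hK.neg_eq] at h
  rwa [h, Set.neg_mem_neg]

theorem IsSymmConvexBody.zero_mem_interior (hK : IsSymmConvexBody K) : (0 : E n) ∈ interior K := by
  obtain ⟨z, hz⟩ := hK.interior_nonempty
  simpa using hK.convex.interior.midpoint_mem hz (hK.neg_mem_interior hz)

theorem IsSymmConvexBody.smul_mem_interior (hK : IsSymmConvexBody K) {x : E n} (hx : x ∈ K)
    {t : ℝ} (ht0 : 0 ≤ t) (ht1 : t < 1) : t • x ∈ interior K := by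
  have h := hK.convex.add_smul_sub_mem_interior hx hK.zero_mem_interior (t := 1 - t)
    ⟨by linarith, by linarith⟩
  convert h using 1
  module

theorem exists_eq_proj_add_smul (v X : E n) : ∃ s : ℝ, X = (proj v X : E n) + s • v := by
  have h : X - (proj v X : E n) ∈ (perp v)ᗮ := Submodule.sub_starProjection_mem_orthogonal X
  rw [Submodule.orthogonal_orthogonal, Submodule.mem_span_singleton] at h
  obtain ⟨s, hs⟩ := h
  exact ⟨s, by rw [hs]; abel⟩

theorem proj_self (v : E n) : proj v v = 0 :=
  Submodule.orthogonalProjectionOnto_orthogonalComplement_singleton_eq_zero v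

theorem proj_coe_add_smul (x : perp v) (s : ℝ) : proj v ((x : E n) + s • v) = x := by
  rw [map_add, map_smul, proj_self, smul_zero, add_zero,
    Submodule.orthogonalProjectionOnto_mem_subspace_eq_self]

/-- The height, in units of `v`, of the upper boundary of `K` over the point `x` of `v^⊥`. -/
noncomputable def top (K : Set (E n)) (v : E n) (x : perp v) : ℝ :=
  sSup {s : ℝ | (x : E n) + s • v ∈ K}

theorem bddAbove_fiber (hK : IsCompact K) (hv : v ≠ 0) (x : perp v) :
    BddAbove {s : ℝ | (x : E n) + s • v ∈ K} := by
  obtain ⟨R, hR⟩ := hK.isBounded.exists_norm_le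
  refine ⟨(R + ‖(x : E n)‖) / ‖v‖, fun s hs => ?_⟩
  rw [le_div_iff₀ (norm_pos_iff.2 hv)]
  calc s * ‖v‖ ≤ |s| * ‖v‖ := by gcongr; exact le_abs_self s
    _ = ‖((x : E n) + s • v) - x‖ := by rw [add_sub_cancel_left, norm_smul, Real.norm_eq_abs]
    _ ≤ ‖(x : E n) + s • v‖ + ‖(x : E n)‖ := norm_sub_le _ _
    _ ≤ R + ‖(x : E n)‖ := by gcongr; exact hR _ hs

theorem le_top (hK : IsCompact K) (hv : v ≠ 0) {x : perp v} {s : ℝ}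
    (hs : (x : E n) + s • v ∈ K) : s ≤ top K v x :=
  le_csSup (bddAbove_fiber hK hv x) hs

theorem top_mem (hK : IsCompact K) (hv : v ≠ 0) {x : perp v} (hx : x ∈ proj v '' K) :
    (x : E n) + top K v x • v ∈ K := by
  have hcl : IsClosed {s : ℝ | (x : E n) + s • v ∈ K} :=
    hK.isClosed.preimage (f := fun s : ℝ => (x : E n) + s • v) (by fun_prop)
  refine hcl.csSup_mem ?_ (bddAbove_fiber hK hv x)
  obtain ⟨X, hX, rfl⟩ := hx
  obtain ⟨s, hs⟩ := exists_eq_proj_add_smul v X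
  exact ⟨s, by rwa [Set.mem_ofPred_eq, ← hs]⟩

theorem concaveOn_top (hK : IsSymmConvexBody K) (hv : v ≠ 0) :
    ConcaveOn ℝ (proj v '' K) (top K v) := by
  refine ⟨hK.convex.linear_image (proj v : E n →ₗ[ℝ] perp v), fun x hx y hy a b ha hb hab => ?_⟩
  refine le_top hK.isCompact hv ?_
  have := hK.convex (top_mem hK.isCompact hv hx) (top_mem hK.isCompact hv hy) ha hb hab
  convert this using 1
  simp only [Submodule.coe_add, Submodule.coe_smul, smul_eq_mul]
  module

theorem neg_mem_image_proj (hK : IsSymmConvexBody K) {x : perp v} (hx : x ∈ proj v '' K) :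
    -x ∈ proj v '' K := by
  obtain ⟨X, hX, rfl⟩ := hx
  exact ⟨-X, hK.neg_mem_iff.2 hX, map_neg _ _⟩

/-- By symmetry the lowest point of the fiber over `x` has height `-top K v (-x)`. -/
theorem add_smul_mem (hK : IsSymmConvexBody K) (hv : v ≠ 0) {x : perp v} (hx : x ∈ proj v '' K)
    {s : ℝ} (h1 : s ≤ top K v x) (h2 : -s ≤ top K v (-x)) : (x : E n) + s • v ∈ K := by
  have hup := top_mem hK.isCompact hv hx
  have hlow : (x : E n) + (-top K v (-x)) • v ∈ K := by
    rw [← hK.neg_mem_iff]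
    convert top_mem hK.isCompact hv (neg_mem_image_proj hK hx) using 1
    rw [Submodule.coe_neg]
    module
  have hconv : Convex ℝ ((fun s : ℝ => (x : E n) + s • v) ⁻¹' K) := by
    intro a ha b hb α β hα hβ hαβ
    have := hK.convex ha hb hα hβ hαβ
    rw [Set.mem_preimage]
    convert this using 1
    obtain rfl : α = 1 - β := by linarith
    simp only [smul_eq_mul]
    module
  exact hconv.ordConnected.out hlow hup ⟨by linarith, h1⟩

/-- If adding multiples of the odd function `β` keeps the upper height function concave, then the
moved bodies are convex. -/
theorem convex_move (hK : IsSymmConvexBody K) (hv : v ≠ 0) {β : perp v → ℝ}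
    (hβ : ∀ x, β (-x) = -β x) {t : ℝ}
    (ht : ConcaveOn ℝ (proj v '' K) fun x => top K v x + t * β x) : Convex ℝ (move K v β t) := by
  have key : ∀ X ∈ K, ∀ Y ∈ K, ∀ a b s : ℝ, 0 ≤ a → 0 ≤ b → a + b = 1 →
      a • X + b • Y = (proj v (a • X + b • Y) : E n) + s • v →
      s + t * (a * β (proj v X) + b * β (proj v Y) - β (proj v (a • X + b • Y))) ≤
        top K v (proj v (a • X + b • Y)) := by
    intro X hX Y hY a b s ha hb hab hs
    obtain ⟨sX, hsX⟩ := exists_eq_proj_add_smul v X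
    obtain ⟨sY, hsY⟩ := exists_eq_proj_add_smul v Y
    have h1 : sX ≤ top K v (proj v X) := le_top hK.isCompact hv (by rwa [← hsX])
    have h2 : sY ≤ top K v (proj v Y) := le_top hK.isCompact hv (by rwa [← hsY])
    have h3 := ht.2 ⟨X, hX, rfl⟩ ⟨Y, hY, rfl⟩ ha hb hab
    have h4 : s = a * sX + b * sY := by
      have h5 : s • v = (a * sX + b * sY) • v := by
        have h6 : s • v = a • X + b • Y - (proj v (a • X + b • Y) : E n) := by
          rw [eq_sub_iff_add_eq, add_comm, ← hs]
        rw [h6, map_add, map_smul, map_smul, Submodule.coe_add, Submodule.coe_smul,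
          Submodule.coe_smul]
        nth_rewrite 1 [hsX]
        nth_rewrite 1 [hsY]
        module
      exact smul_left_injective ℝ hv h5
    rw [← map_smul, ← map_smul, ← map_add] at h3
    simp only [smul_eq_mul] at h3
    have h7 := mul_le_mul_of_nonneg_left h1 ha
    have h8 := mul_le_mul_of_nonneg_left h2 hb
    rw [h4]
    linarith
  rintro _ ⟨X, hX, rfl⟩ _ ⟨Y, hY, rfl⟩ a b ha hb hab
  set Z := a • X + b • Y with hZ
  have hZK : Z ∈ K := hK.convex hX hY ha hb hab
  obtain ⟨s, hs⟩ := exists_eq_proj_add_smul v Z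
  -- The combination of the moved points is the moved image of the point over `proj v Z` at height
  -- `s + t * γ`. That point is in `K`: `key` bounds its height above, and `key` for `-X`, `-Y` with
  -- `β` odd bounds it below.
  set γ := a * β (proj v X) + b * β (proj v Y) - β (proj v Z) with hγ
  have hup : s + t * γ ≤ top K v (proj v Z) := key X hX Y hY a b s ha hb hab hs
  have hlow : -(s + t * γ) ≤ top K v (-proj v Z) := by
    have hneg : a • (-X) + b • (-Y) = -Z := by rw [hZ]; module
    have h1 := key (-X) (hK.neg_mem_iff.2 hX) (-Y) (hK.neg_mem_iff.2 hY) a b (-s) ha hb hab (by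
      rw [hneg, map_neg, Submodule.coe_neg, neg_smul, ← neg_add, ← hs])
    rw [hneg, map_neg, map_neg, map_neg, hβ, hβ, hβ] at h1
    refine le_trans (le_of_eq ?_) h1
    rw [hγ]
    ring
  refine ⟨(proj v Z : E n) + (s + t * γ) • v, add_smul_mem hK hv ⟨Z, hZK, rfl⟩ hup hlow, ?_⟩
  change (proj v Z : E n) + (s + t * γ) • v + (t * β (proj v (_ + (s + t * γ) • v))) • v =
    a • (X + (t * β (proj v X)) • v) + b • (Y + (t * β (proj v Y)) • v)
  rw [proj_coe_add_smul]
  have h1 : (proj v Z : E n) = Z - s • v := by rw [eq_sub_iff_add_eq, ← hs]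
  have h2 : a • X = Z - b • Y := by rw [hZ]; abel
  rw [h1, smul_add, h2, hγ]
  module

/-- A frontier point lying above an interior point is the top point of its fiber. -/
theorem coe_proj_add_top_smul (hK : IsSymmConvexBody K) (hv : v ≠ 0) {m P : E n}
    (hm : m ∈ interior K) (hP : P ∈ frontier K) {s : ℝ} (hs : 0 < s) (hPm : P = m + s • v) :
    (proj v P : E n) + top K v (proj v P) • v = P := by
  have hPK : P ∈ K := hK.isCompact.isClosed.frontier_subset hP
  obtain ⟨σ, hσ⟩ := exists_eq_proj_add_smul v P
  have hle : σ ≤ top K v (proj v P) := le_top hK.isCompact hv (by rwa [← hσ])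
  rcases hle.eq_or_lt with h | hlt
  · rw [← h, ← hσ]
  exfalso
  set τ := top K v (proj v P) - σ with hτ
  have hτ0 : 0 < τ := sub_pos.2 hlt
  have htop := top_mem hK.isCompact hv (x := proj v P) ⟨P, hPK, rfl⟩
  have hT : (proj v P : E n) + top K v (proj v P) • v = m + (s + τ) • v := by
    have h1 : (proj v P : E n) = P - σ • v := by rw [eq_sub_iff_add_eq, ← hσ]
    rw [h1]
    nth_rewrite 1 [hPm]
    rw [hτ]
    module
  rw [hT] at htop
  refine hP.2 ?_
  have h := hK.convex.add_smul_sub_mem_interior htop hm (t := τ / (s + τ))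
    ⟨by positivity, (div_le_one (by positivity)).2 (by linarith)⟩
  convert h using 1
  have h2 : τ = τ / (s + τ) * (s + τ) := by field_simp
  calc P = m + (s + τ) • v - τ • v := by rw [hPm]; module
    _ = m + (s + τ) • v - (τ / (s + τ) * (s + τ)) • v := by rw [← h2]
    _ = _ := by module

theorem proj_mem_interior_image {X : E n} (hX : X ∈ interior K) :
    proj v X ∈ interior (proj v '' K) := by
  have hsurj : Function.Surjective (proj v) := fun x =>
    ⟨x, Submodule.orthogonalProjectionOnto_mem_subspace_eq_self x⟩
  exact interior_maximal (Set.image_mono interior_subset)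
    ((proj v).isOpenMap hsurj _ isOpen_interior) ⟨X, hX, rfl⟩

/-- The upper height function is midpoint strongly concave below points near which `K` is uniformly
convex. -/
theorem UniformlyConvexNear.exists_top_midpoint (hK : IsSymmConvexBody K) (hv : v ≠ 0) {p : E n}
    {r c : ℝ} (h : UniformlyConvexNear K p r c) (hc : 0 < c) {w : perp v}
    (hw : w ∈ interior (proj v '' K)) (hwp : (w : E n) + top K v w • v ∈ Metric.ball p r) :
    ∃ δ : ℝ, 0 < δ ∧ ∀ x ∈ Metric.ball w δ, ∀ y ∈ Metric.ball w δ,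
      x ∈ proj v '' K → y ∈ proj v '' K →
      (top K v x + top K v y) / 2 + c / ‖v‖ * ‖x - y‖ ^ 2 ≤ top K v (midpoint ℝ x y) := by
  have hv0 : 0 < ‖v‖ := norm_pos_iff.2 hv
  have hcont : ContinuousAt (top K v) w :=
    (concaveOn_top hK hv).continuousOn_interior.continuousAt (isOpen_interior.mem_nhds hw)
  have hcont' : ContinuousAt (fun x : perp v => (x : E n) + top K v x • v) w :=
    continuous_subtype_val.continuousAt.add (hcont.smul continuousAt_const)
  obtain ⟨δ, hδ, hball⟩ := Metric.eventually_nhds_iff_ball.1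
    (hcont'.eventually (Metric.isOpen_ball.mem_nhds hwp))
  refine ⟨δ, hδ, fun x hx y hy hxK hyK => ?_⟩
  set X := (x : E n) + top K v x • v with hX
  set Y := (y : E n) + top K v y • v with hY
  have hXY : ‖x - y‖ ≤ ‖X - Y‖ := by
    have h1 : proj v (X - Y) = x - y := by
      rw [map_sub, hX, hY, proj_coe_add_smul, proj_coe_add_smul]
    rw [← h1]
    exact Submodule.norm_orthogonalProjectionOnto_apply_le _ _
  have hmem := h X (top_mem hK.isCompact hv hxK) Y (top_mem hK.isCompact hv hyK) (hball x hx)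
    (hball y hy) (a := midpoint ℝ X Y + (c * ‖X - Y‖ ^ 2 / ‖v‖) • v) (by
      rw [mem_closedBall_iff_norm, add_sub_cancel_left, norm_smul, Real.norm_of_nonneg
        (by positivity), div_mul_cancel₀ _ hv0.ne'])
  have heq : midpoint ℝ X Y + (c * ‖X - Y‖ ^ 2 / ‖v‖) • v = (midpoint ℝ x y : perp v) +
      ((top K v x + top K v y) / 2 + c * ‖X - Y‖ ^ 2 / ‖v‖) • v := by
    simp only [midpoint_eq_smul_add, invOf_eq_inv, Submodule.coe_smul, Submodule.coe_add, hX, hY]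
    module
  rw [heq] at hmem
  refine le_trans ?_ (le_top hK.isCompact hv hmem)
  rw [div_mul_eq_mul_div]
  gcongr

end Top

/-! ### The odd bump and the conclusion -/

/-- An odd `C²` function supported in small balls about `± x₀`, with value `1` at `x₀`. -/
theorem exists_odd_bump {V : Type*} [NormedAddCommGroup V] [InnerProductSpace ℝ V]
    [FiniteDimensional ℝ V] {x₀ : V} {δ : ℝ} (hδ : 0 < δ) (hδx : δ ≤ ‖x₀‖ / 2) :
    ∃ β : V → ℝ, (∀ x, β (-x) = -β x) ∧ β x₀ = 1 ∧ β ((1 / 2 : ℝ) • x₀) = 0 ∧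
      (∀ x, x ∉ Metric.closedBall x₀ δ ∪ Metric.closedBall (-x₀) δ →
        β x = 0 ∧ fderiv ℝ β x = 0) ∧
      ∃ M : ℝ, 0 < M ∧ ∀ y z, |β y - β z - fderiv ℝ β z (y - z)| ≤ M * ‖y - z‖ ^ 2 := by
  let φ : ContDiffBump (0 : V) := ⟨δ / 2, δ, by positivity, by linarith⟩
  have hφ0 : ∀ x, δ ≤ ‖x‖ → φ x = 0 := fun x hx => φ.zero_of_le_dist (by simpa using hx)
  let β : V → ℝ := fun x => φ (x - x₀) - φ (x + x₀)
  have hβS : ∀ x, x ∉ Metric.closedBall x₀ δ ∪ Metric.closedBall (-x₀) δ → β x = 0 := by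
    intro x hx
    rw [Set.mem_union, not_or, mem_closedBall_iff_norm, mem_closedBall_iff_norm, not_le, not_le,
      sub_neg_eq_add] at hx
    simp only [β]
    rw [hφ0 _ hx.1.le, hφ0 _ hx.2.le, sub_zero]
  have hC : ContDiff ℝ 2 β :=
    (φ.contDiff.comp (contDiff_id.sub contDiff_const)).sub
      (φ.contDiff.comp (contDiff_id.add contDiff_const))
  refine ⟨β, fun x => ?_, ?_, ?_, fun x hx => ⟨hβS x hx, ?_⟩, exists_taylor_bound hC ?_⟩
  · simp only [β]
    rw [← φ.neg (-x - x₀), ← φ.neg (-x + x₀), neg_sub', neg_add, neg_neg, neg_sub,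
      sub_neg_eq_add, ← sub_eq_add_neg]
  · simp only [β]
    rw [sub_self, φ.one_of_mem_closedBall (Metric.mem_closedBall_self (by positivity)), hφ0,
      sub_zero]
    have : ‖x₀ + x₀‖ = 2 * ‖x₀‖ := by rw [← two_smul ℝ x₀, norm_smul]; norm_num
    linarith
  · simp only [β]
    have h1 : (1 / 2 : ℝ) • x₀ - x₀ = (-1 / 2 : ℝ) • x₀ := by module
    have h2 : (1 / 2 : ℝ) • x₀ + x₀ = (3 / 2 : ℝ) • x₀ := by module
    rw [h1, h2, hφ0, hφ0, sub_zero]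
    · rw [norm_smul, Real.norm_eq_abs, abs_of_pos (by norm_num)]; linarith
    · rw [norm_smul, Real.norm_eq_abs, abs_of_neg (by norm_num)]; linarith
  · have hopen : IsOpen (Metric.closedBall x₀ δ ∪ Metric.closedBall (-x₀) δ)ᶜ :=
      (Metric.isClosed_closedBall.union Metric.isClosed_closedBall).isOpen_compl
    have h1 : β =ᶠ[𝓝 x] fun _ => (0 : ℝ) := by
      filter_upwards [hopen.mem_nhds hx] with y hy using hβS y hy
    rw [h1.fderiv_eq, fderiv_fun_const, Pi.zero_apply]
  · exact HasCompactSupport.intro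
      ((isCompact_closedBall x₀ δ).union (isCompact_closedBall (-x₀) δ)) hβS

/-- A symmetric convex body that is uniformly convex near a boundary point is SRS-decomposable. -/
theorem srsDecomposable_of_uniformlyConvexNear {n : ℕ} (hn : 2 ≤ n) {K : Set (E n)}
    (hK : IsSymmConvexBody K) {p : E n} (hp : p ∈ frontier K) {r c : ℝ} (hr : 0 < r) (hc : 0 < c)
    (hU : UniformlyConvexNear K p r c) : SRSDecomposable K := by
  have h0 := hK.zero_mem_interior
  have hp0 : 0 < ‖p‖ := norm_pos_iff.2 fun h => hp.2 (h ▸ h0)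
  have hpK : p ∈ K := hK.isCompact.isClosed.frontier_subset hp
  -- Distance below `r` puts `q` in the uniformly convex region; distance below `‖p‖` is what
  -- excludes `x₀ = 0`.
  obtain ⟨q, hq, hqp⟩ := exists_mem_frontier_norm_sub_eq hn hK.convex h0 hp
    (ε := min (r / 2) (‖p‖ / 2)) (by positivity)
    (by rw [zero_sub, norm_neg]; exact (min_le_right _ _).trans (by linarith))
  have hqK : q ∈ K := hK.isCompact.isClosed.frontier_subset hq
  have hqr : ‖q - p‖ < r := hqp ▸ (min_le_left _ _).trans_lt (by linarith)
  have hqp' : ‖q - p‖ < ‖p‖ := hqp ▸ (min_le_right _ _).trans_lt (by linarith)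
  have hqpos : 0 < ‖q - p‖ := hqp ▸ (by positivity)
  set v := p - q with hvdef
  have hvn : ‖v‖ = ‖q - p‖ := norm_sub_rev p q
  have hv : v ≠ 0 := norm_pos_iff.1 (hvn ▸ hqpos)
  set m := midpoint ℝ p q with hm
  have hpball : p ∈ Metric.ball p r := Metric.mem_ball_self hr
  have hqball : q ∈ Metric.ball p r := mem_ball_iff_norm.2 hqr
  have hmi : m ∈ interior K := by
    have h1 := hU p hpK q hqK hpball hqball
    refine mem_interior_iff_mem_nhds.2 (mem_of_superset (Metric.closedBall_mem_nhds _ ?_) h1)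
    have : 0 < ‖p - q‖ := hvn ▸ hqpos
    positivity
  have hpm : p = m + (1 / 2 : ℝ) • v := by
    rw [hm, midpoint_eq_smul_add, invOf_eq_inv, hvdef]; module
  have hqm : -q = -m + (1 / 2 : ℝ) • v := by
    rw [hm, midpoint_eq_smul_add, invOf_eq_inv, hvdef]; module
  set x₀ := proj v p with hx₀
  have hprojq : proj v q = x₀ := by
    have : q = p - v := by rw [hvdef]; abel
    rw [this, map_sub, proj_self, sub_zero]
  have hprojm : proj v m = x₀ := by
    have : m = p - (1 / 2 : ℝ) • v := by rw [eq_sub_iff_add_eq, ← hpm]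
    rw [this, map_sub, map_smul, proj_self, smul_zero, sub_zero]
  -- If `x₀ = 0`, then `p = s • v` and `q = (s - 1) • v` with `|s| > 1`, so one is a multiple of the
  -- other with factor in `[0, 1)` and would be interior.
  have hx₀0 : x₀ ≠ 0 := by
    intro hx
    obtain ⟨s, hs⟩ := exists_eq_proj_add_smul v p
    rw [← hx₀, hx, Submodule.coe_zero, zero_add] at hs
    have hqs : q = (s - 1) • v := by
      have : q = p - v := by rw [hvdef]; abel
      rw [this]
      nth_rewrite 1 [hs]
      module
    have hs1 : 1 < |s| := by
      have h1 : ‖p‖ = |s| * ‖v‖ := by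
        conv_lhs => rw [hs]
        rw [norm_smul, Real.norm_eq_abs]
      rw [← hvn, h1] at hqp'
      have h2 : 0 < ‖v‖ := norm_pos_iff.2 hv
      nlinarith
    rcases lt_abs.1 hs1 with hs1 | hs1
    · refine hq.2 ?_
      have h1 := hK.smul_mem_interior hpK (t := (s - 1) / s)
        (div_nonneg (by linarith) (by linarith)) ((div_lt_one (by linarith)).2 (by linarith))
      have h2 : ((s - 1) / s) • p = q := by
        have h3 : (s - 1) / s * s = s - 1 := by field_simp
        conv_lhs => rw [hs]
        rw [smul_smul, h3, hqs]
      rwa [h2] at h1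
    · refine hp.2 ?_
      have h1 := hK.smul_mem_interior hqK (t := s / (s - 1))
        (div_nonneg_of_nonpos (by linarith) (by linarith))
        ((div_lt_one_of_neg (by linarith)).2 (by linarith))
      have h2 : (s / (s - 1)) • q = p := by
        have h4 : s - 1 ≠ 0 := by linarith
        have h3 : s / (s - 1) * (s - 1) = s := by field_simp
        rw [hqs, smul_smul, h3, ← hs]
      rwa [h2] at h1
  have hpU : (x₀ : E n) + top K v x₀ • v ∈ Metric.ball p r := by
    rw [hx₀, coe_proj_add_top_smul hK hv hmi hp one_half_pos hpm]
    exact hpball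
  have hqfr : -q ∈ frontier K :=
    ⟨subset_closure (hK.neg_mem_iff.2 hqK), fun h => hq.2 (neg_neg q ▸ hK.neg_mem_interior h)⟩
  have hqU : ((-x₀ : perp v) : E n) + top K v (-x₀) • v ∈ Metric.ball (-p) r := by
    rw [← hprojq, ← map_neg, coe_proj_add_top_smul hK hv (hK.neg_mem_interior hmi) hqfr
      one_half_pos hqm, mem_ball_iff_norm, neg_sub_neg, norm_sub_rev]
    exact hqr
  obtain ⟨δ₁, hδ₁, h₁⟩ := hU.exists_top_midpoint hK hv hc
    (hprojm ▸ proj_mem_interior_image hmi) hpU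
  obtain ⟨δ₂, hδ₂, h₂⟩ := (hU.neg hK.neg_eq).exists_top_midpoint hK hv hc
    (w := -x₀) (by
      rw [← hprojm, ← map_neg]; exact proj_mem_interior_image (hK.neg_mem_interior hmi)) hqU
  have hx₀n : 0 < ‖x₀‖ := norm_pos_iff.2 hx₀0
  -- Twice `η` stays below `δ₁` and `δ₂`: once for the radius of the support of `β`, once for the
  -- distance to the second point.
  set η := min δ₁ δ₂ / 3 with hη
  have hη0 : 0 < η := by positivity
  have hη₁ : η + η < δ₁ := by linarith [min_le_left δ₁ δ₂, lt_min hδ₁ hδ₂]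
  have hη₂ : η + η < δ₂ := by linarith [min_le_right δ₁ δ₂, lt_min hδ₁ hδ₂]
  obtain ⟨β, hodd, hβ1, hβ0, hβS, M, hM, hβM⟩ := exists_odd_bump (x₀ := x₀)
    (δ := min η (‖x₀‖ / 2)) (by positivity) (min_le_right _ _)
  obtain ⟨R, hR⟩ := hK.isCompact.isBounded.exists_norm_le
  have hball : ∀ (w x y : perp v) (δ : ℝ), η + η < δ →
      x ∈ Metric.closedBall w (min η (‖x₀‖ / 2)) → ‖x - y‖ ≤ η →
      x ∈ Metric.ball w δ ∧ y ∈ Metric.ball w δ := by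
    intro w x y δ hδ hx hxy
    rw [mem_closedBall_iff_norm] at hx
    have hx' := hx.trans (min_le_left _ _)
    rw [mem_ball_iff_norm, mem_ball_iff_norm]
    have h1 : ‖y - w‖ ≤ ‖x - w‖ + ‖x - y‖ := by
      have : y - w = (x - w) - (x - y) := by abel
      rw [this]
      exact norm_sub_le _ _
    constructor <;> linarith
  obtain ⟨ε, hε, hconc⟩ := exists_concaveOn_add_mul (concaveOn_top hK hv) hη0
    (div_pos hc (norm_pos_iff.2 hv)) (D := 2 * R + 1)
    (by linarith [(norm_nonneg p).trans (hR p hpK)])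
    (by
      rintro _ ⟨X, hX, rfl⟩ _ ⟨Y, hY, rfl⟩
      rw [← map_sub]
      calc ‖proj v (X - Y)‖ ≤ ‖X - Y‖ := Submodule.norm_orthogonalProjectionOnto_apply_le _ _
        _ ≤ ‖X‖ + ‖Y‖ := norm_sub_le _ _
        _ ≤ 2 * R + 1 := by linarith [hR X hX, hR Y hY])
    (by
      intro x hx y hxK hyK hxy
      rcases hx with hx | hx
      · obtain ⟨hx', hy'⟩ := hball _ x y δ₁ hη₁ hx hxy
        exact h₁ x hx' y hy' hxK hyK
      · obtain ⟨hx', hy'⟩ := hball _ x y δ₂ hη₂ hx hxy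
        exact h₂ x hx' y hy' hxK hyK)
    hM hβM hβS
  refine ⟨v, β, ε, hε, ⟨⟨hv, Set.ordConnected_Ioo, by simpa using hε,
    fun t ht => convex_move hK hv hodd (hconc t ht)⟩, fun x _ => hodd x⟩, ?_, ?_⟩
  · simp [move]
  · rintro ⟨l, hl⟩
    have hhalf : (1 / 2 : ℝ) • x₀ ∈ proj v '' K :=
      ⟨(1 / 2 : ℝ) • p, interior_subset (hK.smul_mem_interior hpK (by norm_num) (by norm_num)),
        map_smul _ _ _⟩
    have h1 := hl x₀ ⟨p, hpK, rfl⟩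
    have h2 := hl _ hhalf
    rw [map_smul, ← h1, hβ0, hβ1] at h2
    norm_num at h2

end SRS

theorem mainTheorem12 {n : ℕ} (hn : 2 ≤ n) (K : Set (SRS.E n)) (hK : SRS.IsSymmConvexBody K)
    (U : Set (SRS.E n)) (hUne : U.Nonempty)
    (hUopen : ∃ O : Set (SRS.E n), IsOpen O ∧ U = O ∩ frontier K)
    (hC2 : ∀ p ∈ U, SRS.BoundaryC2At K p)
    (hcurv : ∀ p ∈ U, ∀ κ : ℝ, SRS.IsPrincipalCurvature K p κ → 0 < κ) :
    SRS.SRSDecomposable K := by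
  obtain ⟨p, hpU⟩ := hUne
  obtain ⟨W, ρ, hρ⟩ := hC2 p hpU
  obtain ⟨r, hr, c, hc, hconv⟩ := hρ.exists_uniformlyConvexNear hK (hcurv p hpU)
  exact SRS.srsDecomposable_of_uniformlyConvexNear hn hK hρ.mem_frontier hr hc hconv
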